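/- Let $(T,\mathcal F,\mu)$ be a $\sigma$-finite non-atomic measure space (every $A\in\mathcal F$ with $\mu(A)>0$ contains some $B\in\mathcal F$ with $0<\mu(B)<\mu(A)$), $E$ a real Banach space, $p\in[1,+\infty[$, and let $X\subseteq L^p(T,E)$ be decomposable, i.e. $\chi_A u+(1-\chi_A)v\in X$ for all $u,v\in X$ and $A\in\mathcal F$, where $\chi_A$ is the characteristic function of $A$. Let $[a,b]$ be a compact real interval and $\gamma:[a,b]\to\mathbf R$ a convex (resp. concave) and continuous function. Let $\varphi,\psi,\omega:T\times E\to\mathbf R$ be Carathéodory functions (measurable in $t\in T$ for each fixed $x\in E$, continuous in $x\in E$ for each fixed $t\in T$) such that, for some $M\in L^1(T)$ and $k\in\mathbf R$, $$\max\{|\varphi(t,x)|,|\psi(t,x)|,|\omega(t,x)|\}\le M(t)+k\|x\|^p\qquad\text{for all }(t,x)\in T\times E,$$ and $$\gamma(a)\int_T\psi(t,u(t))\,d\mu+a\int_T\omega(t,u(t))\,d\mu\ \ne\ \gamma(b)\int_T\psi(t,u(t))\,d\mu+b\int_T\omega(t,u(t))\,d\mu$$ for all $u\in X$ such that $\int_T\psi(t,u(t))\,d\mu>0$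 (resp. $\int_T\psi(t,u(t))\,d\mu<0$). Then, with suprema and infima taken in $[-\infty,+\infty]$, $$\sup_{\lambda\in[a,b]}\inf_{u\in X}\int_T\bigl(\varphi(t,u(t))+\gamma(\lambda)\psi(t,u(t))+\lambda\,\omega(t,u(t))\bigr)\,d\mu=\inf_{u\in X}\sup_{\lambda\in[a,b]}\int_T\bigl(\varphi(t,u(t))+\gamma(\lambda)\psi(t,u(t))+\lambda\,\omega(t,u(t))\bigr)\,d\mu .$$ -/

import Mathlib

open MeasureTheory Set
open scoped ENNReal

/-- A measure is non-atomic if every measurable set of positive measure contains a measurable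
subset of positive and strictly smaller measure. (This is not `MeasureTheory.NoAtoms`, which only
says that singletons are null.) -/
def NonAtomic {T : Type*} [MeasurableSpace T] (μ : Measure T) : Prop :=
  ∀ A : Set T, MeasurableSet A → 0 < μ A →
    ∃ B : Set T, B ⊆ A ∧ MeasurableSet B ∧ 0 < μ B ∧ μ B < μ A

/-- `D ⊆ L^p(T,E)` is decomposable if `χ_A u + (1 - χ_A) v` (as an equivalence class) belongs
to `D` for all `u, v ∈ D` and all measurable `A`. -/
def Decomposable {T E : Type*} [MeasurableSpace T] [NormedAddCommGroup E] [NormedSpace ℝ E]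
    {p : ℝ≥0∞} {μ : Measure T} (D : Set (Lp E p μ)) : Prop :=
  ∀ u ∈ D, ∀ v ∈ D, ∀ A : Set T, MeasurableSet A →
    ∃ w ∈ D, (w : T → E) =ᵐ[μ] fun t =>
      A.indicator (fun _ => (1 : ℝ)) t • u t + (1 - A.indicator (fun _ => (1 : ℝ)) t) • v t

/-- A Carathéodory function: measurable in the first variable, continuous in the second. -/
def Caratheodory {T E : Type*} [MeasurableSpace T] [TopologicalSpace E]
    (φ : T → E → ℝ) : Prop :=
  (∀ x : E, Measurable fun t => φ t x) ∧ ∀ t : T, Continuous (φ t)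

open Filter Topology

/-! Write `Φ`, `Ψ`, `Ω` for the three integral functionals. By Lyapunov's convexity theorem and
decomposability, the set `K` of triples `(Φ u, Ψ u, Ω u)`, `u ∈ X`, is convex, so the problem
becomes a minimax for `Φ + γ(λ)Ψ + λΩ` on `K`. For convex `γ` (the concave case follows by negating
`γ` and `ψ`), the graph is enlarged to the compact convex region between it and its chord. There the
payoff is affine in each variable, and Sion's theorem applies although `K` need not be closed.

The endpoint condition brings the parameter back to the graph (`exists_graph_point_of_chordRegion`).
If `s` is the chord's slope, it says that the points `(Ψ, sΨ + Ω)` avoid the open ray `{(y, 0) | y >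
0}`. Separation gives a direction in the parameter plane that lowers no payoff and never crosses the
chord upwards; following it from any point of the region ends on the graph. -/

/-! ### Intermediate values of finite non-atomic measures -/

/-- In a finite non-atomic measure, every non-null set has non-null subsets of arbitrarily small
measure. -/
theorem NonAtomic.exists_subset_lt {T : Type*} [MeasurableSpace T] {ρ : Measure T}
    [IsFiniteMeasure ρ] (hρ : NonAtomic ρ) {S : Set T} (hS : MeasurableSet S) (hS0 : 0 < ρ.real S)
    {ε : ℝ} (hε : 0 < ε) :
    ∃ B ⊆ S, MeasurableSet B ∧ 0 < ρ.real B ∧ ρ.real B < ε := by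
  have key : ∀ n : ℕ, ∃ B ⊆ S, MeasurableSet B ∧ 0 < ρ.real B ∧
      ρ.real B ≤ ρ.real S * (1 / 2) ^ n := by
    intro n
    induction n with
    | zero => exact ⟨S, Subset.rfl, hS, hS0, by simp⟩
    | succ n ih =>
      obtain ⟨B, hBS, hB, hB0, hBn⟩ := ih
      have hB0' : 0 < ρ B := (ENNReal.toReal_pos_iff.1 hB0).1
      obtain ⟨D, hDB, hD, hD0, hDlt⟩ := hρ B hB hB0'
      have h0 : 0 < ρ.real D := ENNReal.toReal_pos hD0.ne' (measure_ne_top _ _)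
      have h1 : ρ.real D < ρ.real B :=
        (ENNReal.toReal_lt_toReal (measure_ne_top _ _) (measure_ne_top _ _)).2 hDlt
      have h2 : ρ.real (B \ D) = ρ.real B - ρ.real D := measureReal_sdiff hDB hD
      rcases le_total (ρ.real D) (ρ.real B / 2) with h | h
      · exact ⟨D, hDB.trans hBS, hD, h0, by rw [pow_succ]; linarith⟩
      · exact ⟨B \ D, sdiff_subset.trans hBS, hB.diff hD, by linarith, by
          rw [pow_succ]; linarith⟩
  have hlim : Tendsto (fun n : ℕ => ρ.real S * (1 / 2 : ℝ) ^ n) atTop (𝓝 (ρ.real S * 0)) :=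
    (tendsto_pow_atTop_nhds_zero_of_lt_one (by norm_num) (by norm_num)).const_mul _
  rw [mul_zero] at hlim
  obtain ⟨n, hn⟩ := (hlim.eventually_lt_const hε).exists
  obtain ⟨B, h1, h2, h3, h4⟩ := key n
  exact ⟨B, h1, h2, h3, h4.trans_lt hn⟩

/-- Sierpiński's theorem: a finite non-atomic measure takes every intermediate value. -/
theorem NonAtomic.exists_subset_eq {T : Type*} [MeasurableSpace T] {ρ : Measure T}
    [IsFiniteMeasure ρ] (hρ : NonAtomic ρ) {S : Set T} (hS : MeasurableSet S)
    {c : ℝ} (hc : 0 ≤ c) (hcS : c ≤ ρ.real S) :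
    ∃ B ⊆ S, MeasurableSet B ∧ ρ.real B = c := by
  let Q : Type _ := {B : Set T // B ⊆ S ∧ MeasurableSet B ∧ ρ.real B ≤ c}
  -- Greedy exhaustion: each step gains at least half of what an admissible superset could still
  -- gain.
  let V : Q → Set ℝ := fun B => {x | ∃ C : Q, B.1 ⊆ C.1 ∧ ρ.real C.1 = x}
  have hVbdd : ∀ B, BddAbove (V B) := fun B => ⟨c, by rintro x ⟨C, -, rfl⟩; exact C.2.2.2⟩
  have step : ∀ B : Q, ∃ C : Q, B.1 ⊆ C.1 ∧ (ρ.real B.1 + sSup (V B)) / 2 ≤ ρ.real C.1 := by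
    intro B
    have hself : ρ.real B.1 ∈ V B := ⟨B, Subset.rfl, rfl⟩
    rcases (le_csSup (hVbdd B) hself).eq_or_lt with h | h
    · exact ⟨B, Subset.rfl, by linarith⟩
    · obtain ⟨x, ⟨C, hBC, rfl⟩, hx⟩ := exists_lt_of_lt_csSup (s := V B) ⟨_, hself⟩
        (show (ρ.real B.1 + sSup (V B)) / 2 < sSup (V B) by linarith)
      exact ⟨C, hBC, hx.le⟩
  choose next hsub hnext using step
  let B : ℕ → Q := fun n => Nat.rec ⟨∅, empty_subset _, MeasurableSet.empty, by simpa⟩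
    (fun _ => next) n
  have hBs : ∀ n, B (n + 1) = next (B n) := fun n => rfl
  have hmono : Monotone fun n => (B n).1 :=
    monotone_nat_of_le_succ fun n => by rw [hBs]; exact hsub _
  let U := ⋃ n, (B n).1
  have hUm : MeasurableSet U := MeasurableSet.iUnion fun n => (B n).2.2.1
  have hUS : U ⊆ S := iUnion_subset fun n => (B n).2.1
  have hlim : Tendsto (fun n => ρ.real (B n).1) atTop (𝓝 (ρ.real U)) :=
    (ENNReal.tendsto_toReal (measure_ne_top _ _)).comp (tendsto_measure_iUnion_atTop hmono)
  have hUc : ρ.real U ≤ c := le_of_tendsto' hlim fun n => (B n).2.2.2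
  refine ⟨U, hUS, hUm, hUc.antisymm (not_lt.1 fun hlt => ?_)⟩
  have hdiff : ρ.real (S \ U) = ρ.real S - ρ.real U := measureReal_sdiff hUS hUm
  obtain ⟨D, hDS, hD, hD0, hDlt⟩ := hρ.exists_subset_lt (hS.diff hUm) (by linarith)
    (sub_pos.2 hlt)
  have hUD : ρ.real (U ∪ D) = ρ.real U + ρ.real D :=
    measureReal_union (disjoint_sdiff_right.mono_right hDS) hD
  -- `U ∪ D` remains admissible above every `B n`, so the greedy gain never falls below a fixed
  -- amount; in the limit this forces `ρ.real D ≤ 0`.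
  have hle : ∀ n, (ρ.real (B n).1 + (ρ.real U + ρ.real D)) / 2 ≤ ρ.real (B (n + 1)).1 := by
    intro n
    have : ρ.real U + ρ.real D ≤ sSup (V (B n)) :=
      le_csSup (hVbdd _) ⟨⟨U ∪ D, union_subset hUS (hDS.trans sdiff_subset), hUm.union hD,
        by rw [hUD]; linarith⟩, (subset_iUnion (fun n => (B n).1) n).trans subset_union_left, hUD⟩
    have h2 := hnext (B n)
    rw [hBs]
    linarith
  have := le_of_tendsto_of_tendsto' ((hlim.add_const _).div_const 2)
    (hlim.comp (tendsto_add_atTop_nat 1)) hle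
  linarith

/-! ### Lyapunov's convexity theorem by successive halving -/

/-- A vector-valued density is halvable if every measurable set has a measurable subset carrying
exactly half of its integral. -/
def Halvable {T V : Type*} [MeasurableSpace T] [NormedAddCommGroup V] [NormedSpace ℝ V]
    (μ : Measure T) (f : T → V) : Prop :=
  ∀ S, MeasurableSet S → ∃ B ⊆ S, MeasurableSet B ∧
    ∫ t in B, f t ∂μ = (1 / 2 : ℝ) • ∫ t in S, f t ∂μ

/-- The measure with density `f` is finite and inherits non-atomicity, because a set it charges
meets `{f > 0}` in a `μ`-positive set that can be split. Sierpiński's theorem then applies. -/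
theorem NonAtomic.halvable_of_nonneg {T : Type*} [MeasurableSpace T] {μ : Measure T}
    (hμ : NonAtomic μ) {f : T → ℝ} (hf : Integrable f μ) (hf0 : ∀ t, 0 ≤ f t) :
    Halvable μ f := by
  let ρ := μ.withDensity fun t => ENNReal.ofReal (f t)
  have : IsFiniteMeasure ρ := isFiniteMeasure_withDensity_ofReal hf.2
  have hfm : AEMeasurable (fun t => ENNReal.ofReal (f t)) μ := hf.1.aemeasurable.ennreal_ofReal
  have hreal : ∀ B, MeasurableSet B → ρ.real B = ∫ t in B, f t ∂μ := by
    intro B hB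
    rw [measureReal_def, withDensity_apply _ hB,
      integral_eq_lintegral_of_nonneg_ae (ae_of_all _ hf0) hf.1.restrict]
  have hpos : ∀ B, MeasurableSet B → (0 < ρ B ↔ 0 < μ (B ∩ {t | 0 < f t})) := by
    intro B hB
    rw [pos_iff_ne_zero, pos_iff_ne_zero, ne_eq, ne_eq, withDensity_apply_eq_zero' hfm]
    simp [inter_comm]
  have hρ : NonAtomic ρ := by
    intro A hA hA0
    rw [hpos A hA] at hA0
    have hnull : NullMeasurableSet (A ∩ {t | 0 < f t}) μ :=
      hA.nullMeasurableSet.inter (nullMeasurableSet_lt aemeasurable_const hf.1.aemeasurable)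
    obtain ⟨A', hA'sub, hA', hA'ae⟩ := hnull.exists_measurable_subset_ae_eq
    obtain ⟨B, hBA, hB, hB0, hBlt⟩ := hμ A' hA' (by rwa [measure_congr hA'ae])
    have hBA2 : B ⊆ A ∩ {t | 0 < f t} := hBA.trans hA'sub
    have hBA3 : B ⊆ A := hBA2.trans inter_subset_left
    refine ⟨B, hBA3, hB, (hpos B hB).2 ?_, ?_⟩
    · rwa [inter_eq_self_of_subset_left (hBA2.trans inter_subset_right)]
    · have h1 : 0 < ρ (A \ B) := by
        rw [hpos _ (hA.diff hB)]
        refine lt_of_lt_of_le ?_ (measure_mono (show A' \ B ⊆ _ from fun t ht =>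
          ⟨⟨(hA'sub ht.1).1, ht.2⟩, (hA'sub ht.1).2⟩))
        rw [measure_sdiff hBA hB.nullMeasurableSet hBlt.ne_top]
        exact tsub_pos_of_lt hBlt
      rw [measure_sdiff hBA3 hB.nullMeasurableSet (measure_ne_top _ _)] at h1
      exact tsub_pos_iff_lt.1 h1
  intro S hS
  obtain ⟨B, hBS, hB, hBc⟩ := hρ.exists_subset_eq hS (c := 1 / 2 * ρ.real S) (by positivity)
    (by linarith [measureReal_nonneg (μ := ρ) (s := S)])
  exact ⟨B, hBS, hB, by rw [← hreal B hB, ← hreal S hS, hBc, smul_eq_mul]⟩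

/-- Repeated halving produces a chain along which the integral grows linearly. -/
theorem Halvable.exists_chain {T V : Type*} [MeasurableSpace T] [NormedAddCommGroup V]
    [NormedSpace ℝ V] [CompleteSpace V] {μ : Measure T} {f : T → V} (hf : Integrable f μ)
    (h : Halvable μ f) {S : Set T} (hS : MeasurableSet S) :
    ∃ A : ℝ → Set T, Monotone A ∧ (∀ t, MeasurableSet (A t)) ∧ (∀ t, A t ⊆ S) ∧
      ∀ t ∈ Icc (0 : ℝ) 1, ∫ x in A t, f x ∂μ = t • ∫ x in S, f x ∂μ := by
  choose! H hHsub hHm hHint using h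
  -- Dyadic chain: `D n k` carries the fraction `k / 2 ^ n` of the integral. Odd indices insert half
  -- of the gap between neighbours of the previous level.
  let D : ℕ → ℕ → Set T := fun n => Nat.rec (fun k => if k = 0 then ∅ else S)
    (fun _ D k => if Even k then D (k / 2) else D (k / 2) ∪ H (D (k / 2 + 1) \ D (k / 2))) n
  have hD0 : ∀ k, D 0 k = if k = 0 then ∅ else S := fun k => rfl
  have hDs : ∀ n k, D (n + 1) k = if Even k then D n (k / 2) else
      D n (k / 2) ∪ H (D n (k / 2 + 1) \ D n (k / 2)) := fun n k => rfl
  have hDm : ∀ n k, MeasurableSet (D n k) := by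
    intro n
    induction n with
    | zero => intro k; rw [hD0]; split_ifs <;> simp [hS]
    | succ n ih =>
      intro k
      rw [hDs]
      split_ifs
      · exact ih _
      · exact (ih _).union (hHm _ ((ih _).diff (ih _)))
  have hDmono : ∀ n k, D n k ⊆ D n (k + 1) := by
    intro n
    induction n with
    | zero => intro k; rw [hD0, hD0]; split_ifs <;> simp_all
    | succ n ih =>
      intro k
      rw [hDs, hDs]
      rcases Nat.even_or_odd k with hk | hk
      · have h2 : ¬ Even (k + 1) := by grind
        have h3 : (k + 1) / 2 = k / 2 := by grind
        rw [if_pos hk, if_neg h2, h3]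
        exact subset_union_left
      · have h1 : ¬ Even k := by grind
        have h2 : Even (k + 1) := by grind
        have h3 : (k + 1) / 2 = k / 2 + 1 := by grind
        rw [if_neg h1, if_pos h2, h3]
        exact union_subset (ih _) ((hHsub _ ((hDm _ _).diff (hDm _ _))).trans sdiff_subset)
  have hDmono' : ∀ n, Monotone (D n) := fun n => monotone_nat_of_le_succ (hDmono n)
  have hDS : ∀ n k, D n k ⊆ S := by
    intro n
    induction n with
    | zero => intro k; rw [hD0]; split_ifs <;> simp
    | succ n ih =>
      intro k
      rw [hDs]
      split_ifs
      · exact ih _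
      · exact union_subset (ih _) ((hHsub _ ((hDm _ _).diff (hDm _ _))).trans
          (sdiff_subset.trans (ih _)))
  have hDint : ∀ n k, k ≤ 2 ^ n →
      ∫ x in D n k, f x ∂μ = ((k : ℝ) / 2 ^ n) • ∫ x in S, f x ∂μ := by
    intro n
    induction n with
    | zero =>
      intro k hk
      have : k = 0 ∨ k = 1 := by simp at hk; omega
      rcases this with rfl | rfl <;> simp [hD0]
    | succ n ih =>
      intro k hk
      rw [hDs]
      rw [pow_succ] at hk
      rcases Nat.even_or_odd' k with ⟨j, rfl | rfl⟩
      · rw [if_pos (by simp), show 2 * j / 2 = j by omega, ih j (by omega)]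
        congr 1
        push_cast
        field_simp
        ring
      · rw [if_neg (by grind), show (2 * j + 1) / 2 = j by omega]
        have hm := (hDm n (j + 1)).diff (hDm n j)
        rw [setIntegral_union (disjoint_sdiff_right.mono_right (hHsub _ hm)) (hHm _ hm)
          hf.integrableOn hf.integrableOn, hHint _ hm,
          setIntegral_sdiff (hDm n j) hf.integrableOn (hDmono n j), ih j (by omega),
          ih (j + 1) (by omega), ← sub_smul, smul_smul, ← add_smul]
        congr 1
        push_cast
        field_simp
        ring
  let A : ℝ → Set T := fun t => ⋃ n : ℕ, D n ⌊t * 2 ^ n⌋₊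
  refine ⟨A, fun s t hst => ?_, fun t => MeasurableSet.iUnion fun n => hDm _ _,
    fun t => iUnion_subset fun n => hDS _ _, fun t ht => ?_⟩
  · exact iUnion_mono fun n => hDmono' n (Nat.floor_mono (by gcongr))
  · have hmono : Monotone fun n : ℕ => D n ⌊t * 2 ^ n⌋₊ := by
      refine monotone_nat_of_le_succ fun n => ?_
      have h1 : D n ⌊t * 2 ^ n⌋₊ = D (n + 1) (2 * ⌊t * 2 ^ n⌋₊) := by
        rw [hDs, if_pos (by simp)]
        congr 1
        omega
      change D n ⌊t * 2 ^ n⌋₊ ⊆ _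
      rw [h1]
      refine hDmono' (n + 1) (Nat.le_floor ?_ : 2 * ⌊t * 2 ^ n⌋₊ ≤ ⌊t * 2 ^ (n + 1)⌋₊)
      push_cast
      have := Nat.floor_le (show 0 ≤ t * 2 ^ n by have := ht.1; positivity)
      rw [pow_succ]
      linarith
    have hlim := tendsto_setIntegral_of_monotone (fun n => hDm n ⌊t * 2 ^ n⌋₊) hmono
      (hf.integrableOn (s := ⋃ n : ℕ, D n ⌊t * 2 ^ n⌋₊))
    refine tendsto_nhds_unique hlim ?_
    have h2 : ∀ n : ℕ, ∫ x in D n ⌊t * 2 ^ n⌋₊, f x ∂μ =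
        ((⌊t * 2 ^ n⌋₊ : ℝ) / 2 ^ n) • ∫ x in S, f x ∂μ := by
      intro n
      refine hDint n _ (Nat.floor_le_of_le ?_)
      push_cast
      have := ht.2
      have h3 : (0 : ℝ) < 2 ^ n := by positivity
      nlinarith
    simp_rw [h2]
    refine Tendsto.smul_const ?_ _
    exact (tendsto_nat_floor_mul_div_atTop (R := ℝ) ht.1).comp
      (tendsto_pow_atTop_atTop_of_one_lt (by norm_num : (1 : ℝ) < 2))

/-- Along a chain for `f`, every increment `A (t + 1 / 2) \ A t` has half of the integral of `f`.
The domination by `L ∘ f` makes the integral of `g` Lipschitz in `t`, so the intermediate value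
theorem finds a `t` that halves `g` too. -/
theorem Halvable.prodMk {T V : Type*} [MeasurableSpace T] [NormedAddCommGroup V]
    [NormedSpace ℝ V] [CompleteSpace V] {μ : Measure T} {f : T → V} (hf : Integrable f μ)
    (h : Halvable μ f) (L : V →L[ℝ] ℝ) {g : T → ℝ} (hg : Integrable g μ)
    (hgL : ∀ t, |g t| ≤ L (f t)) :
    Halvable μ fun t => (f t, g t) := by
  intro S hS
  obtain ⟨A, hmono, hm, hsub, hint⟩ := h.exists_chain hf hS
  have hdiff : ∀ s t, s ≤ t → ∫ x in A t \ A s, g x ∂μ =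
      ∫ x in A t, g x ∂μ - ∫ x in A s, g x ∂μ := fun s t hst =>
    setIntegral_sdiff (hm s) hg.integrableOn (hmono hst)
  let G : ℝ → ℝ := fun t => ∫ x in A t, g x ∂μ
  let c := L (∫ x in S, f x ∂μ)
  have hLint : ∀ t ∈ Icc (0 : ℝ) 1, ∫ x in A t, L (f x) ∂μ = t * c := by
    intro t ht
    rw [L.integral_comp_comm hf.integrableOn, hint t ht, map_smul, smul_eq_mul]
  have hLip : ∀ s ∈ Icc (0 : ℝ) 1, ∀ t ∈ Icc (0 : ℝ) 1, s ≤ t → |G t - G s| ≤ (t - s) * c := by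
    intro s hs t ht hst
    have hLf := L.integrable_comp hf
    calc |G t - G s| = ‖∫ x in A t \ A s, g x ∂μ‖ := by rw [hdiff s t hst]; rfl
      _ ≤ ∫ x in A t \ A s, L (f x) ∂μ :=
        norm_integral_le_of_norm_le hLf.integrableOn (ae_of_all _ hgL)
      _ = (t - s) * c := by
        rw [setIntegral_sdiff (hm s) hLf.integrableOn (hmono hst), hLint t ht, hLint s hs]
        ring
  have hc : 0 ≤ c := by
    have := (abs_nonneg _).trans (hLip 0 (by simp) 1 (by simp) zero_le_one)
    linarith
  have hGc : ContinuousOn G (Icc 0 1) := by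
    refine (LipschitzOnWith.of_dist_le_mul (K := c.toNNReal) fun t ht s hs => ?_).continuousOn
    rw [Real.dist_eq, Real.dist_eq, Real.coe_toNNReal _ hc]
    rcases le_total s t with hst | hst
    · rw [abs_of_nonneg (sub_nonneg.2 hst), mul_comm]
      exact hLip s hs t ht hst
    · rw [abs_sub_comm (G t), abs_sub_comm t, abs_of_nonneg (sub_nonneg.2 hst), mul_comm]
      exact hLip t ht s hs hst
  -- `A 0` may be nonempty and `A 1` smaller than `S`, but the discrepancy does not affect the
  -- integral of `g`.
  have hnull : ∀ {B C : Set T}, MeasurableSet B → MeasurableSet C → B ⊆ C →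
      ∫ x in B, f x ∂μ = ∫ x in C, f x ∂μ → ∫ x in B, g x ∂μ = ∫ x in C, g x ∂μ := by
    intro B C hB hC hBC hfBC
    have hLf := L.integrable_comp hf
    have h1 : |∫ x in C \ B, g x ∂μ| ≤ ∫ x in C \ B, L (f x) ∂μ := by
      rw [← Real.norm_eq_abs]
      exact norm_integral_le_of_norm_le hLf.integrableOn (ae_of_all _ hgL)
    rw [setIntegral_sdiff hB hLf.integrableOn hBC, setIntegral_sdiff hB hg.integrableOn hBC,
      L.integral_comp_comm hf.integrableOn, L.integral_comp_comm hf.integrableOn, hfBC,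
      sub_self] at h1
    linarith [abs_nonpos_iff.1 h1]
  have hG0 : G 0 = 0 := by
    have := hnull MeasurableSet.empty (hm 0) (empty_subset _)
      (by rw [hint 0 (by simp)]; simp)
    simpa using this.symm
  have hG1 : G 1 = ∫ x in S, g x ∂μ :=
    hnull (hm 1) hS (hsub 1) (by rw [hint 1 (by simp)]; simp)
  have hFc : ContinuousOn (fun t => G (t + 1 / 2) - G t) (Icc 0 (1 / 2)) := by
    refine (hGc.comp (by fun_prop) fun t ht => ?_).sub
      (hGc.mono (Icc_subset_Icc le_rfl (by norm_num)))
    exact ⟨by linarith [ht.1], by linarith [ht.2]⟩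
  obtain ⟨t, ht, htG⟩ : (1 / 2 * ∫ x in S, g x ∂μ) ∈
      (fun t => G (t + 1 / 2) - G t) '' (Icc 0 (1 / 2)) := by
    -- The values at `0` and `1 / 2` add up to `G 1`, so `G 1 / 2` lies between them.
    have hpre := (isPreconnected_Icc (a := (0 : ℝ)) (b := 1 / 2)).image _ hFc
    have m0 : G (1 / 2) ∈ (fun t => G (t + 1 / 2) - G t) '' (Icc 0 (1 / 2)) :=
      ⟨0, by norm_num, by simp [hG0]⟩
    have m1 : G 1 - G (1 / 2) ∈ (fun t => G (t + 1 / 2) - G t) '' (Icc 0 (1 / 2)) :=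
      ⟨1 / 2, by norm_num, by norm_num⟩
    rcases le_total (G (1 / 2)) (G 1 - G (1 / 2)) with hle | hle
    · exact hpre.ordConnected.out m0 m1 ⟨by linarith, by linarith⟩
    · exact hpre.ordConnected.out m1 m0 ⟨by linarith, by linarith⟩
  have htt : t ≤ t + 1 / 2 := by linarith
  refine ⟨A (t + 1 / 2) \ A t, sdiff_subset.trans (hsub _), (hm _).diff (hm _), ?_⟩
  rw [integral_pair hf.integrableOn hg.integrableOn, integral_pair hf.integrableOn hg.integrableOn,
    Prod.smul_mk, hdiff _ _ htt, setIntegral_sdiff (hm _) hf.integrableOn (hmono htt),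
    hint t ⟨ht.1, by linarith [ht.2]⟩, hint (t + 1 / 2) ⟨by linarith [ht.1], by linarith [ht.2]⟩,
    ← sub_smul, add_sub_cancel_left, smul_eq_mul, ← htG]

/-- Lyapunov's convexity theorem for three densities. -/
theorem NonAtomic.exists_setIntegral_eq_mul {T : Type*} [MeasurableSpace T] {μ : Measure T}
    (hμ : NonAtomic μ) {f g h : T → ℝ} (hf : Integrable f μ) (hg : Integrable g μ)
    (hh : Integrable h μ) {θ : ℝ} (hθ : θ ∈ Icc (0 : ℝ) 1) :
    ∃ A, MeasurableSet A ∧ ∫ t in A, f t ∂μ = θ * ∫ t, f t ∂μ ∧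
      ∫ t in A, g t ∂μ = θ * ∫ t, g t ∂μ ∧ ∫ t in A, h t ∂μ = θ * ∫ t, h t ∂μ := by
  -- A single nonnegative density dominating all three; its coordinate serves as `L ∘ f` each time a
  -- density is adjoined.
  let w : T → ℝ := fun t => |f t| + |g t| + |h t|
  have hw : Integrable w μ := (hf.abs.add hg.abs).add hh.abs
  have h0 : Halvable μ w := hμ.halvable_of_nonneg hw fun t => by positivity
  have h1 := h0.prodMk hw (ContinuousLinearMap.id ℝ ℝ) hf fun t => by
    change |f t| ≤ |f t| + |g t| + |h t|
    linarith [abs_nonneg (g t), abs_nonneg (h t)]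
  have h2 := h1.prodMk (hw.prodMk hf) (ContinuousLinearMap.fst ℝ ℝ ℝ) hg fun t => by
    change |g t| ≤ |f t| + |g t| + |h t|
    linarith [abs_nonneg (f t), abs_nonneg (h t)]
  have h3 := h2.prodMk ((hw.prodMk hf).prodMk hg)
    ((ContinuousLinearMap.fst ℝ ℝ ℝ).comp (ContinuousLinearMap.fst ℝ (ℝ × ℝ) ℝ)) hh fun t => by
    change |h t| ≤ |f t| + |g t| + |h t|
    linarith [abs_nonneg (f t), abs_nonneg (g t)]
  obtain ⟨A, -, hm, -, hint⟩ := h3.exists_chain (((hw.prodMk hf).prodMk hg).prodMk hh)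
    MeasurableSet.univ
  have := hint θ hθ
  rw [setIntegral_univ, integral_pair ((hw.prodMk hf).prodMk hg).integrableOn hh.integrableOn,
    integral_pair (hw.prodMk hf).integrableOn hg.integrableOn,
    integral_pair hw.integrableOn hf.integrableOn, integral_pair ((hw.prodMk hf).prodMk hg) hh,
    integral_pair (hw.prodMk hf) hg, integral_pair hw hf] at this
  simp only [Prod.smul_mk, Prod.mk.injEq, smul_eq_mul] at this
  exact ⟨A θ, hm θ, this.1.1.2, this.1.2, this.2⟩

/-! ### Separation in the plane -/

/-- `κ` is the infimum of the slopes `p.2 / p.1` over the points of `P` in the right half-plane. A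
point on the left violating the bound would be joined to one on the right by a segment meeting the
forbidden ray. -/
theorem exists_le_and_sub_mul_nonneg {P : Set (ℝ × ℝ)} (hP : Convex ℝ P)
    (hpos : ∀ q ∈ P, 0 < q.1 → 0 < q.2) (hne : ∃ q ∈ P, 0 < q.1) :
    ∃ κ : ℝ, 0 ≤ κ ∧ ∀ q ∈ P, 0 ≤ q.2 - κ * q.1 := by
  have hcross : ∀ p ∈ P, 0 < p.1 → ∀ q ∈ P, q.1 ≤ 0 → 0 ≤ q.2 * p.1 - p.2 * q.1 := by
    intro p hp hp1 q hq hq1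
    by_contra! hlt
    have hp2 := hpos p hp hp1
    have hq2 : q.2 < 0 := by nlinarith
    -- the point of the segment at second coordinate `0` has positive first coordinate
    have hs : 0 < p.2 - q.2 := by linarith
    have hmem := hP hp hq (a := -q.2 / (p.2 - q.2)) (b := p.2 / (p.2 - q.2))
      (div_nonneg (by linarith) hs.le) (by positivity) (by field_simp; ring)
    have h2 := hpos _ hmem
    simp only [Prod.fst_add, Prod.smul_fst, smul_eq_mul, Prod.snd_add, Prod.smul_snd] at h2
    have e1 : -q.2 / (p.2 - q.2) * p.1 + p.2 / (p.2 - q.2) * q.1 =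
      (-(q.2 * p.1 - p.2 * q.1)) / (p.2 - q.2) := by field_simp; ring
    have e2 : -q.2 / (p.2 - q.2) * p.2 + p.2 / (p.2 - q.2) * q.2 = 0 := by field_simp; ring
    rw [e1, e2] at h2
    exact lt_irrefl _ (h2 (div_pos (by linarith) hs))
  let R : Set ℝ := {x | ∃ p ∈ P, 0 < p.1 ∧ p.2 / p.1 = x}
  have hRne : R.Nonempty := by
    obtain ⟨p, hp, hp1⟩ := hne
    exact ⟨_, p, hp, hp1, rfl⟩
  have hR0 : ∀ x ∈ R, 0 ≤ x := by
    rintro x ⟨p, hp, hp1, rfl⟩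
    exact (div_pos (hpos p hp hp1) hp1).le
  refine ⟨sInf R, le_csInf hRne hR0, fun q hq => ?_⟩
  rcases lt_trichotomy q.1 0 with h | h | h
  · have : q.2 / q.1 ≤ sInf R := by
      refine le_csInf hRne ?_
      rintro x ⟨p, hp, hp1, rfl⟩
      have := hcross p hp hp1 q hq h.le
      rw [div_le_iff_of_neg h, div_mul_eq_mul_div, div_le_iff₀ hp1]
      linarith
    rw [div_le_iff_of_neg h] at this
    linarith
  · obtain ⟨p, hp, hp1⟩ := hne
    have := hcross p hp hp1 q hq h.le
    rw [h] at this ⊢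
    have : 0 ≤ q.2 := by
      by_contra! hc
      nlinarith
    linarith
  · have : sInf R ≤ q.2 / q.1 := csInf_le ⟨0, hR0⟩ ⟨q, hq, h, rfl⟩
    rw [le_div_iff₀ h] at this
    linarith

/-- Separation of a convex subset of the plane from the open ray `{(y, 0) | y > 0}`. -/
theorem exists_functional_nonneg_of_disjoint_ray {P : Set (ℝ × ℝ)} (hP : Convex ℝ P)
    (hray : ∀ q ∈ P, 0 < q.1 → q.2 ≠ 0) :
    ∃ α β : ℝ, α ≤ 0 ∧ (α ≠ 0 ∨ β ≠ 0) ∧ ∀ q ∈ P, 0 ≤ α * q.1 + β * q.2 := by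
  by_cases hne : ∃ q ∈ P, 0 < q.1
  swap
  · push Not at hne
    exact ⟨-1, 0, by norm_num, by norm_num, fun q hq => by linarith [hne q hq]⟩
  -- The right half of `P` is convex, so its second coordinate, never zero there, has constant sign.
  have hpre : IsPreconnected (Prod.snd '' (P ∩ {q | 0 < q.1})) := by
    refine IsPreconnected.image ?_ _ continuous_snd.continuousOn
    exact (hP.inter (convex_halfSpace_gt ⟨fun _ _ => rfl, fun _ _ => rfl⟩ 0)).isPreconnected
  have h0 : (0 : ℝ) ∉ Prod.snd '' (P ∩ {q | 0 < q.1}) := by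
    rintro ⟨q, ⟨hq, hq1⟩, hq2⟩
    exact hray q hq hq1 hq2
  obtain ⟨p, hp, hp1⟩ := hne
  rcases lt_or_gt_of_ne (hray p hp hp1) with hp2 | hp2
  · have hneg : ∀ q ∈ P, 0 < q.1 → 0 < -q.2 := fun q hq hq1 => by
      by_contra! hc
      exact h0 (hpre.ordConnected.out ⟨p, ⟨hp, hp1⟩, rfl⟩ ⟨q, ⟨hq, hq1⟩, rfl⟩
        ⟨hp2.le, by linarith⟩)
    let ℓ : ℝ × ℝ →ₗ[ℝ] ℝ × ℝ := (LinearMap.fst ℝ ℝ ℝ).prod (-LinearMap.snd ℝ ℝ ℝ)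
    obtain ⟨κ, hκ, h⟩ := exists_le_and_sub_mul_nonneg (hP.linear_image ℓ)
      (by rintro _ ⟨q, hq, rfl⟩; exact hneg q hq) ⟨ℓ p, ⟨p, hp, rfl⟩, hp1⟩
    refine ⟨-κ, -1, by linarith, by norm_num, fun q hq => ?_⟩
    have : 0 ≤ -q.2 - κ * q.1 := h _ ⟨q, hq, rfl⟩
    linarith
  · have hpos : ∀ q ∈ P, 0 < q.1 → 0 < q.2 := fun q hq hq1 => by
      by_contra! hc
      exact h0 (hpre.ordConnected.out ⟨q, ⟨hq, hq1⟩, rfl⟩ ⟨p, ⟨hp, hp1⟩, rfl⟩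
        ⟨by linarith, hp2.le⟩)
    obtain ⟨κ, hκ, h⟩ := exists_le_and_sub_mul_nonneg hP hpos ⟨p, hp, hp1⟩
    refine ⟨-κ, 1, by linarith, by norm_num, fun q hq => ?_⟩
    linarith [h q hq]

/-! ### From the chord region back to the graph -/

/-- The region between the graph of `γ` over `[a, b]` and the line of slope `s` through
`(a, γ a)`. -/
def chordRegion (γ : ℝ → ℝ) (a b s : ℝ) : Set (ℝ × ℝ) :=
  {c | c.1 ∈ Icc a b ∧ γ c.1 ≤ c.2 ∧ c.2 ≤ γ a + s * (c.1 - a)}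

theorem isCompact_chordRegion {γ : ℝ → ℝ} {a b : ℝ} (s : ℝ) (hγ : ContinuousOn γ (Icc a b)) :
    IsCompact (chordRegion γ a b s) := by
  -- Boundedness: each point interpolates between graph and chord, with a weight in `[0, 1]`.
  have himg : chordRegion γ a b s ⊆
      Icc a b ×ˢ ((fun q : ℝ × ℝ => (1 - q.2) * γ q.1 + q.2 * (γ a + s * (q.1 - a))) ''
        (Icc a b ×ˢ Icc (0 : ℝ) 1)) := by
    rintro ⟨m, g⟩ ⟨hm, h1, h2⟩
    dsimp only at hm h1 h2
    refine ⟨hm, ?_⟩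
    rcases (h1.trans h2).eq_or_lt with h | h
    · exact ⟨(m, 0), ⟨hm, by simp⟩, by simp; linarith⟩
    · refine ⟨(m, (g - γ m) / (γ a + s * (m - a) - γ m)), ⟨hm, ?_, ?_⟩, ?_⟩
      · exact div_nonneg (by linarith) (by linarith)
      · exact (div_le_one (by linarith)).2 (by linarith)
      · have : γ a + s * (m - a) - γ m ≠ 0 := by linarith
        dsimp only
        field_simp
        ring
  have hγ1 : ContinuousOn (fun q : ℝ × ℝ => γ q.1) (Icc a b ×ˢ univ) :=
    hγ.comp continuousOn_fst fun q hq => hq.1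
  have hcpt : IsCompact (Icc a b ×ˢ
      ((fun q : ℝ × ℝ => (1 - q.2) * γ q.1 + q.2 * (γ a + s * (q.1 - a))) ''
        (Icc a b ×ˢ Icc (0 : ℝ) 1))) := by
    refine isCompact_Icc.prod ((isCompact_Icc.prod isCompact_Icc).image_of_continuousOn ?_)
    have := hγ1.mono (prod_mono_right (subset_univ (Icc (0 : ℝ) 1)))
    exact ((continuousOn_const.sub continuousOn_snd).mul this).add (by fun_prop)
  refine hcpt.of_isClosed_subset ?_ himg
  have h1 : IsClosed ((Icc a b ×ˢ univ) ∩ (fun q : ℝ × ℝ => q.2 - γ q.1) ⁻¹' Ici 0) :=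
    (continuousOn_snd.sub hγ1).preimage_isClosed_of_isClosed (isClosed_Icc.prod isClosed_univ)
      isClosed_Ici
  have h2 : IsClosed {q : ℝ × ℝ | q.2 ≤ γ a + s * (q.1 - a)} :=
    isClosed_le (by fun_prop) (by fun_prop)
  convert h1.inter h2 using 1
  ext q
  simp only [chordRegion, mem_ofPred_eq, mem_inter_iff, mem_prod, mem_univ, and_true, mem_preimage,
    mem_Ici, sub_nonneg, and_assoc]

theorem convex_chordRegion {γ : ℝ → ℝ} {a b : ℝ} (s : ℝ) (hγ : ConvexOn ℝ (Icc a b) γ) :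
    Convex ℝ (chordRegion γ a b s) := by
  have h2 : Convex ℝ {q : ℝ × ℝ | q.2 ≤ γ a + s * (q.1 - a)} := by
    intro p hp q hq x y hx hy hxy
    simp only [mem_ofPred_eq, Prod.fst_add, Prod.smul_fst, smul_eq_mul, Prod.snd_add,
      Prod.smul_snd] at *
    obtain rfl : y = 1 - x := by linarith
    nlinarith [mul_le_mul_of_nonneg_left hp hx, mul_le_mul_of_nonneg_left hq hy]
  convert hγ.convex_epigraph.inter h2 using 1
  ext q
  simp only [chordRegion, mem_ofPred_eq, mem_inter_iff, and_assoc]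

/-- If the lower bound `r` holds on `K` at some point of the region above a convex graph, then it
holds at a point of the graph. -/
theorem exists_graph_point_of_chordRegion {γ : ℝ → ℝ} {a b s : ℝ} (hs : γ b = γ a + s * (b - a))
    (hγ : ContinuousOn γ (Icc a b))
    {K : Set (ℝ × ℝ × ℝ)} (hK : Convex ℝ K)
    (hray : ∀ q ∈ K, 0 < q.2.1 → s * q.2.1 + q.2.2 ≠ 0) {r : ℝ} {c : ℝ × ℝ}
    (hc : c ∈ chordRegion γ a b s) (hcr : ∀ q ∈ K, r ≤ q.1 + c.2 * q.2.1 + c.1 * q.2.2) :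
    ∃ l ∈ Icc a b, ∀ q ∈ K, r ≤ q.1 + γ l * q.2.1 + l * q.2.2 := by
  let ℓ : ℝ × ℝ × ℝ →ₗ[ℝ] ℝ × ℝ :=
    ((LinearMap.fst ℝ ℝ ℝ).prod (s • LinearMap.fst ℝ ℝ ℝ + LinearMap.snd ℝ ℝ ℝ)).comp
      (LinearMap.snd ℝ ℝ (ℝ × ℝ))
  obtain ⟨α, β, hα, hαβ, hnn⟩ := exists_functional_nonneg_of_disjoint_ray (hK.linear_image ℓ)
    (by rintro _ ⟨q, hq, rfl⟩; exact hray q hq)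
  have hnn' : ∀ q ∈ K, 0 ≤ (α + β * s) * q.2.1 + β * q.2.2 := by
    intro q hq
    -- Thus moving `c` along `(β, α + β * s)` lowers no payoff, and `α ≤ 0` keeps it below the
    -- chord.
    have : 0 ≤ α * q.2.1 + β * (s * q.2.1 + q.2.2) := hnn _ ⟨q, hq, rfl⟩
    linarith
  let d : ℝ := α + β * s
  have hd : 0 < β * β + d * d := by
    rcases eq_or_ne β 0 with h | h
    · have : d ≠ 0 := by simpa [d, h] using hαβ
      have := mul_self_pos.2 this
      nlinarith [mul_self_nonneg β]
    · have := mul_self_pos.2 h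
      nlinarith [mul_self_nonneg d]
  let Cr := chordRegion γ a b s ∩ {c | ∀ q ∈ K, r ≤ q.1 + c.2 * q.2.1 + c.1 * q.2.2}
  have hCr : IsCompact Cr := by
    refine (isCompact_chordRegion s hγ).inter_right ?_
    simp only [ofPred_forall]
    exact isClosed_biInter fun q _ => isClosed_le (by fun_prop) (by fun_prop)
  obtain ⟨m, ⟨⟨hmI, hmγ, hms⟩, hmr⟩, hmax⟩ := hCr.exists_isMaxOn ⟨c, hc, hcr⟩
    (f := fun c => β * c.1 + d * c.2) (by fun_prop)
  rcases hmγ.eq_or_lt with heq | hlt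
  · exact ⟨m.1, hmI, fun q hq => by rw [heq]; exact hmr q hq⟩
  exfalso
  -- Over `a` and `b` the chord meets the graph, so a point strictly above the graph lies over the
  -- open interval and can be pushed further.
  have ha : a < m.1 := lt_of_le_of_ne hmI.1 fun h => by
    rw [← h] at hlt hms
    simp at hms
    linarith
  have hb : m.1 < b := lt_of_le_of_ne hmI.2 fun h => by
    rw [h] at hlt hms
    linarith
  have hcont : ContinuousAt γ m.1 := hγ.continuousAt (Icc_mem_nhds ha hb)
  have hline : Tendsto (fun ε : ℝ => m.1 + ε * β) (𝓝[>] 0) (𝓝 m.1) := by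
    have : Tendsto (fun ε : ℝ => m.1 + ε * β) (𝓝 0) (𝓝 (m.1 + 0 * β)) :=
      Continuous.tendsto (by fun_prop) _
    rw [zero_mul, add_zero] at this
    exact this.mono_left nhdsWithin_le_nhds
  have hline2 : Tendsto (fun ε : ℝ => m.2 + ε * d) (𝓝[>] 0) (𝓝 m.2) := by
    have : Tendsto (fun ε : ℝ => m.2 + ε * d) (𝓝 0) (𝓝 (m.2 + 0 * d)) :=
      Continuous.tendsto (by fun_prop) _
    rw [zero_mul, add_zero] at this
    exact this.mono_left nhdsWithin_le_nhds
  obtain ⟨ε, ⟨hε1, hε2⟩, hε0⟩ := (((hline.eventually (Icc_mem_nhds ha hb)).and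
    ((hcont.tendsto.comp hline).eventually_lt hline2 hlt)).and self_mem_nhdsWithin).exists
  have hmem : ((m.1 + ε * β, m.2 + ε * d) : ℝ × ℝ) ∈ Cr := by
    refine ⟨⟨hε1, hε2.le, ?_⟩, fun q hq => ?_⟩
    · dsimp only [d]
      nlinarith
    · have h1 := hmr q hq
      have h2 := mul_nonneg hε0.le (hnn' q hq)
      dsimp only [d]
      linarith
  have : β * (m.1 + ε * β) + d * (m.2 + ε * d) ≤ β * m.1 + d * m.2 := hmax hmem
  nlinarith [mul_pos hε0 hd]

/-! ### Minimax over a convex set of triples -/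

/-- Sion's minimax theorem for a bi-affine function, in the form used for strict bounds. -/
theorem exists_forall_lt_of_forall_exists_lt {C : Set (ℝ × ℝ)} (hC : IsCompact C)
    (hCc : Convex ℝ C) (hCn : C.Nonempty) {K : Set (ℝ × ℝ × ℝ)} (hK : Convex ℝ K) {r : ℝ}
    (h : ∀ c ∈ C, ∃ q ∈ K, q.1 + c.2 * q.2.1 + c.1 * q.2.2 < r) :
    ∃ q ∈ K, ∀ c ∈ C, q.1 + c.2 * q.2.1 + c.1 * q.2.2 < r := by
  choose! k hkK hk using h
  obtain ⟨t, ht, hcov⟩ := hC.elim_nhdsWithin_subcover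
    (fun c => {c' : ℝ × ℝ | (k c).1 + c'.2 * (k c).2.1 + c'.1 * (k c).2.2 < r})
    fun c hc => mem_nhdsWithin_of_mem_nhds
      ((isOpen_lt (by fun_prop) (by fun_prop)).mem_nhds (hk c hc))
  obtain ⟨q, hq, hqlt⟩ := Sion.exists_lt_iInf_of_lt_iInf_of_finite
    (f := fun (c : ℝ × ℝ) (q : ℝ × ℝ × ℝ) => -(q.1 + c.2 * q.2.1 + c.1 * q.2.2))
    (X := C) (Y := K) hCn hC
    (fun q _ => ContinuousOn.lowerSemicontinuousOn (by fun_prop))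
    (fun q _ => ConvexOn.quasiconvexOn ⟨hCc, fun p _ p' _ x y _ _ hxy => le_of_eq (by
      obtain rfl : y = 1 - x := by linarith
      simp
      ring)⟩)
    hK
    (fun c _ => ContinuousOn.upperSemicontinuousOn (by fun_prop))
    (fun c _ => ConcaveOn.quasiconcaveOn ⟨hK, fun p _ p' _ x y _ _ hxy => le_of_eq (by
      obtain rfl : y = 1 - x := by linarith
      simp
      ring)⟩)
    hCc (s := k '' t) (t.finite_toSet.image k)
    (by rintro _ ⟨c, hc, rfl⟩; exact hkK c (ht c hc)) (t := -r)
    (fun c hc => by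
      obtain ⟨c', hc', hlt⟩ := mem_iUnion₂.1 (hcov hc)
      exact ⟨k c', ⟨c', hc', rfl⟩, neg_lt_neg hlt⟩)
  exact ⟨q, hq, fun c hc => neg_lt_neg_iff.1 (hqlt c hc)⟩

theorem exists_forall_lt_of_convexOn {K : Set (ℝ × ℝ × ℝ)} (hK : Convex ℝ K) {a b : ℝ}
    (hab : a ≤ b) {γ : ℝ → ℝ} (hγ : ContinuousOn γ (Icc a b)) (hγc : ConvexOn ℝ (Icc a b) γ)
    (hends : ∀ q ∈ K, 0 < q.2.1 → γ a * q.2.1 + a * q.2.2 ≠ γ b * q.2.1 + b * q.2.2) {r : ℝ}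
    (h : ∀ l ∈ Icc a b, ∃ q ∈ K, q.1 + γ l * q.2.1 + l * q.2.2 < r) :
    ∃ q ∈ K, ∀ l ∈ Icc a b, q.1 + γ l * q.2.1 + l * q.2.2 < r := by
  rcases hab.eq_or_lt with rfl | hlt
  · obtain ⟨q, hq, hlt⟩ := h a (by simp)
    refine ⟨q, hq, fun l hl => ?_⟩
    obtain rfl : l = a := by simpa using hl
    exact hlt
  have hba : 0 < b - a := sub_pos.2 hlt
  let s := (γ b - γ a) / (b - a)
  have hs : γ b = γ a + s * (b - a) := by
    simp only [s]
    field_simp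
    ring
  have hray : ∀ q ∈ K, 0 < q.2.1 → s * q.2.1 + q.2.2 ≠ 0 := by
    -- The two endpoint values differ by `(b - a) * (s * q.2.1 + q.2.2)`.
    intro q hq hq1 h0
    refine hends q hq hq1 ?_
    rw [hs]
    linear_combination (-(b - a)) * h0
  have hgraph : ∀ l ∈ Icc a b, (l, γ l) ∈ chordRegion γ a b s := by
    intro l hl
    refine ⟨hl, le_rfl, ?_⟩
    have := hγc.2 (left_mem_Icc.2 hab) (right_mem_Icc.2 hab)
      (show 0 ≤ (b - l) / (b - a) from div_nonneg (by linarith [hl.2]) hba.le)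
      (show 0 ≤ (l - a) / (b - a) from div_nonneg (by linarith [hl.1]) hba.le)
      (by field_simp; ring)
    simp only [smul_eq_mul] at this
    have e1 : (b - l) / (b - a) * a + (l - a) / (b - a) * b = l := by field_simp; ring
    have e2 : (b - l) / (b - a) * γ a + (l - a) / (b - a) * γ b = γ a + s * (l - a) := by
      simp only [s]
      field_simp
      ring
    rwa [e1, e2] at this
  obtain ⟨q, hq, hqr⟩ := exists_forall_lt_of_forall_exists_lt (isCompact_chordRegion s hγ)
    (convex_chordRegion s hγc) ⟨_, hgraph a (left_mem_Icc.2 hab)⟩ hK (r := r) fun c hc => by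
      by_contra! hcon
      obtain ⟨l, hl, hlr⟩ := exists_graph_point_of_chordRegion hs hγ hK hray hc hcon
      obtain ⟨q, hq, hqlt⟩ := h l hl
      exact absurd (hlr q hq) (not_le.2 hqlt)
  exact ⟨q, hq, fun l hl => hqr _ (hgraph l hl)⟩

/-! ### Integral functionals on decomposable sets -/

theorem Caratheodory.measurable_comp {T E : Type*} [MeasurableSpace T] [TopologicalSpace E]
    {φ : T → E → ℝ} (hφ : Caratheodory φ) {u : T → E} (hu : StronglyMeasurable u) :
    Measurable fun t => φ t (u t) := by
  refine measurable_of_tendsto_metrizable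
    (fun n => (hu.approx n).measurable_bind (fun x t => φ t x) hφ.1) ?_
  exact tendsto_pi_nhds.2 fun t => ((hφ.2 t).tendsto _).comp (hu.tendsto_approx t)

theorem Caratheodory.integrable_comp {T E : Type*} [MeasurableSpace T] {μ : Measure T}
    [NormedAddCommGroup E] {φ : T → E → ℝ} (hφ : Caratheodory φ) {p : ℝ≥0∞} (hp : p ≠ 0)
    (hp' : p ≠ ∞) {M : T → ℝ} (hM : Integrable M μ) {k : ℝ}
    (hgrowth : ∀ t x, |φ t x| ≤ M t + k * ‖x‖ ^ p.toReal) (u : Lp E p μ) :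
    Integrable (fun t => φ t (u t)) μ := by
  have hu : Integrable (fun t => ‖u t‖ ^ p.toReal) μ := (Lp.memLp u).integrable_norm_rpow hp hp'
  exact (hM.add (hu.const_mul k)).mono'
    (hφ.measurable_comp (Lp.stronglyMeasurable u)).aestronglyMeasurable
    (ae_of_all _ fun t => hgrowth t (u t))

theorem integral_comp_eq_of_ae_eq_piecewise {T E : Type*} [MeasurableSpace T] {μ : Measure T}
    [NormedAddCommGroup E] [NormedSpace ℝ E] {φ : T → E → ℝ} {u v w : T → E} {A : Set T}
    (hA : MeasurableSet A) (hu : Integrable (fun t => φ t (u t)) μ)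
    (hv : Integrable (fun t => φ t (v t)) μ)
    (hw : w =ᵐ[μ] fun t =>
      A.indicator (fun _ => (1 : ℝ)) t • u t + (1 - A.indicator (fun _ => (1 : ℝ)) t) • v t) :
    ∫ t, φ t (w t) ∂μ = ∫ t, φ t (v t) ∂μ + ∫ t in A, (φ t (u t) - φ t (v t)) ∂μ := by
  have hd : Integrable (fun t => φ t (u t) - φ t (v t)) μ := hu.sub hv
  rw [← integral_indicator hA, ← integral_add hv (hd.indicator hA)]
  refine integral_congr_ae (hw.mono fun t ht => ?_)
  by_cases h : t ∈ A <;> simp [ht, h]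

/-- The joint range of three integral functionals over a decomposable set is convex. -/
theorem Decomposable.convex_image_integral {T E : Type*} [MeasurableSpace T] {μ : Measure T}
    (hμ : NonAtomic μ) [NormedAddCommGroup E] [NormedSpace ℝ E] {p : ℝ≥0∞}
    {X : Set (Lp E p μ)} (hX : Decomposable X) {φ ψ ω : T → E → ℝ}
    (hφ : ∀ u : Lp E p μ, Integrable (fun t => φ t (u t)) μ)
    (hψ : ∀ u : Lp E p μ, Integrable (fun t => ψ t (u t)) μ)
    (hω : ∀ u : Lp E p μ, Integrable (fun t => ω t (u t)) μ) :
    Convex ℝ ((fun u : Lp E p μ =>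
      (∫ t, φ t (u t) ∂μ, ∫ t, ψ t (u t) ∂μ, ∫ t, ω t (u t) ∂μ)) '' X) := by
  rintro _ ⟨u, hu, rfl⟩ _ ⟨v, hv, rfl⟩ x y hx hy hxy
  -- Splicing `u` on `A` with `v` off `A` adds to the integrals of `v` the fraction `x` of each
  -- difference.
  obtain ⟨A, hA, h1, h2, h3⟩ := hμ.exists_setIntegral_eq_mul ((hφ u).sub (hφ v))
    ((hψ u).sub (hψ v)) ((hω u).sub (hω v)) (θ := x) ⟨hx, by linarith⟩
  obtain ⟨w, hw, hwe⟩ := hX u hu v hv A hA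
  refine ⟨w, hw, ?_⟩
  obtain rfl : y = 1 - x := by linarith
  simp only [Pi.sub_apply] at h1 h2 h3
  rw [integral_sub (hφ u) (hφ v)] at h1
  rw [integral_sub (hψ u) (hψ v)] at h2
  rw [integral_sub (hω u) (hω v)] at h3
  dsimp only
  rw [integral_comp_eq_of_ae_eq_piecewise hA (hφ u) (hφ v) hwe,
    integral_comp_eq_of_ae_eq_piecewise hA (hψ u) (hψ v) hwe,
    integral_comp_eq_of_ae_eq_piecewise hA (hω u) (hω v) hwe, h1, h2, h3]
  ext <;> simp <;> ring

/-! ### The minimax equality -/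

theorem theorem6 {T E : Type*} [MeasurableSpace T] (μ : Measure T) [SigmaFinite μ]
    (hμ : NonAtomic μ)
    [NormedAddCommGroup E] [NormedSpace ℝ E] [CompleteSpace E]
    (p : ℝ≥0∞) (hp : 1 ≤ p) (hp' : p ≠ ∞)
    (X : Set (Lp E p μ)) (hX : Decomposable X)
    (a b : ℝ) (hab : a ≤ b)
    (γ : ℝ → ℝ) (hγ : ContinuousOn γ (Icc a b))
    (φ ψ ω : T → E → ℝ)
    (hφ : Caratheodory φ) (hψ : Caratheodory ψ) (hω : Caratheodory ω)
    (M : T → ℝ) (hM : Integrable M μ) (k : ℝ)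
    (hgrowth : ∀ (t : T) (x : E),
      max (max |φ t x| |ψ t x|) |ω t x| ≤ M t + k * ‖x‖ ^ p.toReal)
    (hends :
      (ConvexOn ℝ (Icc a b) γ ∧
        ∀ u ∈ X, 0 < (∫ t, ψ t (u t) ∂μ) →
          γ a * (∫ t, ψ t (u t) ∂μ) + a * (∫ t, ω t (u t) ∂μ) ≠
            γ b * (∫ t, ψ t (u t) ∂μ) + b * (∫ t, ω t (u t) ∂μ)) ∨
      (ConcaveOn ℝ (Icc a b) γ ∧
        ∀ u ∈ X, (∫ t, ψ t (u t) ∂μ) < 0 →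
          γ a * (∫ t, ψ t (u t) ∂μ) + a * (∫ t, ω t (u t) ∂μ) ≠
            γ b * (∫ t, ψ t (u t) ∂μ) + b * (∫ t, ω t (u t) ∂μ))) :
    (⨆ l ∈ Icc a b, ⨅ u ∈ X,
        ((∫ t, (φ t (u t) + γ l * ψ t (u t) + l * ω t (u t)) ∂μ : ℝ) : EReal)) =
      ⨅ u ∈ X, ⨆ l ∈ Icc a b,
        ((∫ t, (φ t (u t) + γ l * ψ t (u t) + l * ω t (u t)) ∂μ : ℝ) : EReal) := by
  have hp0 : p ≠ 0 := (zero_lt_one.trans_le hp).ne'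
  have hgφ : ∀ t x, |φ t x| ≤ M t + k * ‖x‖ ^ p.toReal := fun t x =>
    ((le_max_left _ _).trans (le_max_left _ _)).trans (hgrowth t x)
  have hgψ : ∀ t x, |ψ t x| ≤ M t + k * ‖x‖ ^ p.toReal := fun t x =>
    ((le_max_right _ _).trans (le_max_left _ _)).trans (hgrowth t x)
  have hgω : ∀ t x, |ω t x| ≤ M t + k * ‖x‖ ^ p.toReal := fun t x =>
    (le_max_right _ _).trans (hgrowth t x)
  have iφ := hφ.integrable_comp hp0 hp' hM hgφ
  have iψ := hψ.integrable_comp hp0 hp' hM hgψ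
  have iω := hω.integrable_comp hp0 hp' hM hgω
  have hint : ∀ (u : Lp E p μ) (l : ℝ), ∫ t, (φ t (u t) + γ l * ψ t (u t) + l * ω t (u t)) ∂μ =
      (∫ t, φ t (u t) ∂μ) + γ l * (∫ t, ψ t (u t) ∂μ) + l * ∫ t, ω t (u t) ∂μ := by
    intro u l
    have hsum : Integrable (fun t => φ t (u t) + γ l * ψ t (u t)) μ :=
      (iφ u).add ((iψ u).const_mul _)
    rw [integral_add hsum ((iω u).const_mul _),
      integral_add (iφ u) ((iψ u).const_mul _), integral_const_mul, integral_const_mul]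
  simp_rw [hint]
  have hcore : ∀ r : ℝ, (∀ l ∈ Icc a b, ∃ u ∈ X, (∫ t, φ t (u t) ∂μ) +
      γ l * (∫ t, ψ t (u t) ∂μ) + l * ∫ t, ω t (u t) ∂μ < r) →
      ∃ u ∈ X, ∀ l ∈ Icc a b, (∫ t, φ t (u t) ∂μ) +
        γ l * (∫ t, ψ t (u t) ∂μ) + l * ∫ t, ω t (u t) ∂μ < r := by
    intro r hr
    rcases hends with ⟨hc, hne⟩ | ⟨hc, hne⟩
    · have := exists_forall_lt_of_convexOn (hX.convex_image_integral hμ iφ iψ iω) hab hγ hc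
        (by simpa only [forall_mem_image] using hne) (r := r)
        (by simpa only [exists_mem_image] using hr)
      simpa only [exists_mem_image] using this
    -- Negating both `γ` and `ψ` preserves the payoff and reverses the sign condition on the
    -- integral of `ψ`.
    · have := exists_forall_lt_of_convexOn (hX.convex_image_integral hμ (ψ := fun t x => -ψ t x)
        iφ (fun u => (iψ u).neg) iω) hab hγ.neg hc.neg
        (by simpa only [forall_mem_image, integral_neg, Pi.neg_apply, neg_mul_neg, neg_pos]
          using hne) (r := r)
        (by simpa only [exists_mem_image, integral_neg, Pi.neg_apply, neg_mul_neg] using hr)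
      simpa only [exists_mem_image, integral_neg, Pi.neg_apply, neg_mul_neg] using this
  apply le_antisymm
  · exact iSup₂_le fun l hl => le_iInf₂ fun u hu =>
      (iInf₂_le u hu).trans (le_iSup₂ (f := fun l (_ : l ∈ Icc a b) =>
        (((∫ t, φ t (u t) ∂μ) + γ l * (∫ t, ψ t (u t) ∂μ) + l * ∫ t, ω t (u t) ∂μ : ℝ) : EReal))
        l hl)
  · by_contra! hlt
    obtain ⟨r, hr1, hr2⟩ := EReal.lt_iff_exists_real_btwn.1 hlt
    obtain ⟨u, hu, hur⟩ := hcore r fun l hl => by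
      have h1 := (le_iSup₂ (f := fun l (_ : l ∈ Icc a b) => ⨅ u ∈ X,
        (((∫ t, φ t (u t) ∂μ) + γ l * (∫ t, ψ t (u t) ∂μ) + l * ∫ t, ω t (u t) ∂μ : ℝ) : EReal))
        l hl).trans_lt hr1
      simpa only [iInf_lt_iff, EReal.coe_lt_coe_iff, exists_prop] using h1
    refine absurd (hr2.trans_le (iInf₂_le u hu)) (not_lt.2 (iSup₂_le fun l hl => ?_))
    exact EReal.coe_le_coe_iff.2 (hur l hl).le
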